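/- Let $n\ge 0$, let $G$ be a finite simple graph with vertex set $[n]=\{1,\ldots,n\}$, and let $\chi_G$ be its chromatic polynomial, i.e. the unique polynomial such that $\chi_G(q)$ is the number of proper $q$-colorings of $G$ for every positive integer $q$. For $U\subseteq[n]$, let $G[U]$ be the subgraph of $G$ induced by $U$. An orientation is acyclic if it has no directed cycle; a source of an orientation is a vertex without any ingoing edge. **Theorem.** Let $0\le d\le n$ be an integer such that the vertices $1,2,\ldots,d$ are pairwise adjacent, and let $$\widehat{\chi}_d(q):=\frac{\chi_G(q)}{q(q-1)\cdots(q-d+1)},$$ where the denominator is $1$ for $d=0$, so that $\widehat{\chi}_0=\chi_G$. Then $\widehat{\chi}_d(q)$ is a polynomial in $q$ (with integer coefficients), and for all non-negative integers $i,j$ the number $(-1)^{n-d-i}\,\widehat{\chi}_d^{(i)}(-j)$, where $\widehat{\chi}_d^{(i)}$ is the $i$-th derivative, is the number of tuples $((V_1,\gamma_1),\ldots,(V_{d+i+j},\gamma_{d+i+j}))$ such that - $V_1,\ldots,V_{d+i+j}$ are pairwise disjoint (possibly empty) subsets of $[n]$ with $\bigcup_k V_k=[n]$, and $k\in V_k$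 for all $k\in[d]$; - for all $k\in[d+i+j]$, $\gamma_k$ is an acyclic orientation of $G[V_k]$, and if $k\le d+i$ then $V_k\neq\emptyset$ and $\gamma_k$ has a unique source, which is the vertex $\min(V_k)$. -/

import Mathlib

open Polynomial

section ChromaticPolynomial

variable {V : Type*}

/-- Proper colorings, sorted by the partition of the vertices into color classes. -/
noncomputable def coloringEquivSigmaSetoid (G : SimpleGraph V) (α : Type*) :
    G.Coloring α ≃
      Σ s : {s : Setoid V // ∀ v w, G.Adj v w → ¬ s v w}, (Quotient s.1 ↪ α) where
  toFun f := ⟨⟨Setoid.ker f, fun _ _ h => f.valid h⟩,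
    ⟨Setoid.kerLift f, Setoid.kerLift_injective f⟩⟩
  invFun p := SimpleGraph.Coloring.mk (fun v => p.2 (Quotient.mk p.1.1 v)) (by
    intro v w h heq
    exact p.1.2 v w h (Quotient.exact (p.2.injective heq)))
  left_inv f := by
    ext v
    rfl
  right_inv p := by
    obtain ⟨⟨s, hs⟩, g⟩ := p
    have key : ∀ (s' : Setoid V) (hs' : ∀ v w, G.Adj v w → ¬ s' v w) (g' : Quotient s' ↪ α),
        s' = s → (∀ v, g' (Quotient.mk s' v) = g (Quotient.mk s v)) →
        (⟨⟨s', hs'⟩, g'⟩ : Σ s : {s : Setoid V // ∀ v w, G.Adj v w → ¬ s v w},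
          (Quotient s.1 ↪ α)) = ⟨⟨s, hs⟩, g⟩ := by
      intro s' hs' g' h hg
      subst h
      congr 1
      ext x
      induction x using Quotient.inductionOn with
      | h v => exact hg v
    apply key
    · ext v w
      refine ⟨fun h => Quotient.exact (g.injective h), fun h => ?_⟩
      exact congrArg g (Quotient.sound h)
    · intro v
      rfl

/-- There is exactly one polynomial whose value at every positive integer `q` is the number of
proper `q`-colorings of the finite graph `G`. -/
theorem existsUnique_chromaticPolynomial [Finite V] (G : SimpleGraph V) :
    ∃! P : ℤ[X], ∀ q : ℕ, 0 < q → P.eval (q : ℤ) = Nat.card (G.Coloring (Fin q)) := by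
  classical
  have : Fintype V := Fintype.ofFinite V
  have : Finite (Setoid V) :=
    Finite.of_injective (fun s : Setoid V => (fun v w => s v w : V → V → Prop)) (by
      intro s t h
      ext v w
      exact iff_of_eq (congrFun (congrFun h v) w))
  have : Fintype {s : Setoid V // ∀ v w, G.Adj v w → ¬ s v w} := Fintype.ofFinite _
  refine ⟨∑ s : {s : Setoid V // ∀ v w, G.Adj v w → ¬ s v w},
    descPochhammer ℤ (Nat.card (Quotient s.1)), ?_, ?_⟩
  · intro q _
    rw [Nat.card_congr (coloringEquivSigmaSetoid G (Fin q)), Nat.card_sigma, eval_finsetSum]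
    push_cast
    refine Finset.sum_congr rfl fun s _ => ?_
    have : Fintype (Quotient s.1) := Fintype.ofFinite _
    rw [descPochhammer_eval_eq_descFactorial, Nat.card_eq_fintype_card, Nat.card_eq_fintype_card,
      Fintype.card_embedding_eq, Fintype.card_fin]
  · intro Q hQ
    refine Polynomial.eq_of_infinite_eval_eq _ _ ?_
    refine Set.Infinite.mono (s := Set.range fun k : ℕ => ((k + 1 : ℕ) : ℤ)) ?_
      (Set.infinite_range_of_injective ?_)
    · rintro _ ⟨k, rfl⟩
      simp only [Set.mem_ofPred_eq]
      rw [hQ (k + 1) k.succ_pos]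
      rw [Nat.card_congr (coloringEquivSigmaSetoid G (Fin (k + 1))), Nat.card_sigma,
        eval_finsetSum]
      push_cast
      refine Finset.sum_congr rfl fun s _ => ?_
      have : Fintype (Quotient s.1) := Fintype.ofFinite _
      have := descPochhammer_eval_eq_descFactorial ℤ (k + 1) (Nat.card (Quotient s.1))
      push_cast at this
      rw [this, Nat.card_eq_fintype_card, Nat.card_eq_fintype_card,
        Fintype.card_embedding_eq, Fintype.card_fin]
    · intro a b h
      simpa using h

/-- The chromatic polynomial `χ_G` of a finite graph: the polynomial whose value at every positive
integer `q` is the number of proper `q`-colorings of `G`. -/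
noncomputable def chromaticPoly [Finite V] (G : SimpleGraph V) : ℤ[X] :=
  (existsUnique_chromaticPolynomial G).choose

theorem chromaticPoly_eval [Finite V] (G : SimpleGraph V) (q : ℕ) (hq : 0 < q) :
    (chromaticPoly G).eval (q : ℤ) = Nat.card (G.Coloring (Fin q)) :=
  (existsUnique_chromaticPolynomial G).choose_spec.1 q hq

theorem eq_chromaticPoly [Finite V] (G : SimpleGraph V) (P : ℤ[X])
    (h : ∀ q : ℕ, 0 < q → P.eval (q : ℤ) = Nat.card (G.Coloring (Fin q))) :
    P = chromaticPoly G :=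
  (existsUnique_chromaticPolynomial G).choose_spec.2 P h

/-- The rational function `χ_G(q) / (q (q - 1) ⋯ (q - d + 1))`. -/
noncomputable def chromaticQuotient [Finite V] (G : SimpleGraph V) (d : ℕ) : RatFunc ℤ :=
  algebraMap ℤ[X] (RatFunc ℤ) (chromaticPoly G) /
    algebraMap ℤ[X] (RatFunc ℤ) (∏ k ∈ Finset.range d, (X - C (k : ℤ)))

end ChromaticPolynomial

section Orientations

variable {W : Type*}

/-- An orientation of a graph `H`: each edge `{u, v}` is given exactly one of its two directions;
`arc u v` says that there is an edge `{u, v}` and that it is directed from `u` to `v`. -/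
@[ext] structure GraphOrientation (H : SimpleGraph W) where
  arc : W → W → Prop
  adj_iff : ∀ u v, H.Adj u v ↔ (arc u v ∨ arc v u)
  asymm : ∀ u v, arc u v → ¬ arc v u

/-- There is no directed cycle, that is, no nonempty closed directed path. -/
def GraphOrientation.IsAcyclic {H : SimpleGraph W} (γ : GraphOrientation H) : Prop :=
  ∀ v, ¬ Relation.TransGen γ.arc v v

/-- A vertex without any ingoing edge. -/
def GraphOrientation.IsSource {H : SimpleGraph W} (γ : GraphOrientation H) (v : W) : Prop :=
  ∀ u, ¬ γ.arc u v

instance [Finite W] (H : SimpleGraph W) : Finite (GraphOrientation H) :=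
  Finite.of_injective GraphOrientation.arc fun _ _ h => GraphOrientation.ext h

end Orientations

/-- A pair `(U, γ)` of a set `U` of vertices and an orientation `γ` of the induced subgraph
`G[U]`. -/
abbrev OrientedPart {n : ℕ} (G : SimpleGraph (Fin n)) : Type :=
  Σ U : Finset (Fin n), GraphOrientation (G.induce (U : Set (Fin n)))

/-- `U` is nonempty and `γ` has a unique source, which is the vertex `min U`. -/
def OrientedPart.HasUniqueSourceMin {n : ℕ} {G : SimpleGraph (Fin n)} (p : OrientedPart G) :
    Prop :=
  ∃ h : p.1.Nonempty, ∀ v : (p.1 : Set (Fin n)), p.2.IsSource v ↔ (v : Fin n) = p.1.min' h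

/-- The conditions on `((V_1, γ_1), …, (V_{d+i+j}, γ_{d+i+j}))`. Vertices and positions are
numbered from `0` here, so that `k ∈ [d]` becomes `k < d`. -/
structure IsAdmissibleTuple {n : ℕ} (G : SimpleGraph (Fin n)) (d i j : ℕ)
    (t : Fin (d + i + j) → OrientedPart G) : Prop where
  disjoint : ∀ k l, k ≠ l → Disjoint (t k).1 (t l).1
  cover : ∀ v, ∃ k, v ∈ (t k).1
  mem : ∀ (v : Fin n) (k : Fin (d + i + j)), (k : ℕ) < d → (v : ℕ) = k → v ∈ (t k).1
  acyclic : ∀ k, (t k).2.IsAcyclic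
  source : ∀ k : Fin (d + i + j), (k : ℕ) < d + i → (t k).HasUniqueSourceMin

/-! Functions on vertex sets form a commutative ring under subset convolution, in which a product
sums over ordered decompositions of a set. Let `I` be the indicator of independent sets
(`indepFun`), `a` the number of acyclic orientations (`acyclicFun`), `σ` the automorphism `signed`,
and `χ` the chromatic polynomials of all induced subgraphs (`chromaticFun`). Color classes give
`χ(q) = I ^ q`. By inclusion-exclusion over sources `I * σ a = 1`, hence `χ(-j) = (σ a) ^ j`, which
is Stanley's reciprocity. From `χ(q + r) = χ(q) χ(r)` follows `χ' = L χ` with `L = χ'(0)`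
(`linearFun`): every derivative contributes a factor `L`.

Restriction to the sets containing `v`, written `δ_v` (`point v`), is a derivation. Sorting acyclic
orientations by the set reachable from `v` gives `δ_v a = s_v a`, where `s_v` counts those with
unique source `v`. It follows that `δ_v L = -σ s_v` and `δ_v χ(q) = q (δ_v L) χ(q)`. Taking `v = min
U` yields `L = -σ m` with `m` = `minSourceFun`.

No independent set contains two adjacent vertices, so `δ_u δ_v I = 0`, which becomes `δ_u δ_v L =
-(δ_u L)(δ_v L)`. Applying `δ` for the vertices of a `d`-clique therefore extracts `q`, `q - 1`, …,
`q - d + 1` in turn, and the quotient is the value of `(∏ δ_k L) χ` at the whole vertex set. Its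
`i`-th derivative at `-j` is the value of `(∏ δ_k L) L ^ i (σ a) ^ j`, which up to sign is that of
`(∏ δ_k m) m ^ i a ^ j`, the number of tuples. -/

/-! ### The ring of set functions under subset convolution -/

/-- Functions on the finite subsets of `V`, multiplied by the subset convolution
`(f * g) U = ∑ f A * g (U \ A)`, the sum being over the subsets `A` of `U`. -/
@[ext] structure SetFun (V R : Type*) where
  /-- the value at a finite set -/
  val : Finset V → R

namespace SetFun

variable {V R S : Type*} [CommRing R] [CommRing S]

instance : Zero (SetFun V R) := ⟨⟨fun _ => 0⟩⟩
instance : Add (SetFun V R) := ⟨fun f g => ⟨fun U => f.val U + g.val U⟩⟩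
instance : Neg (SetFun V R) := ⟨fun f => ⟨fun U => -f.val U⟩⟩

@[simp] theorem val_zero (U : Finset V) : (0 : SetFun V R).val U = 0 := rfl
@[simp] theorem val_add (f g : SetFun V R) (U : Finset V) : (f + g).val U = f.val U + g.val U := rfl
@[simp] theorem val_neg (f : SetFun V R) (U : Finset V) : (-f).val U = -f.val U := rfl

variable [DecidableEq V]

instance : One (SetFun V R) := ⟨⟨fun U => if U = ∅ then 1 else 0⟩⟩
instance : Mul (SetFun V R) := ⟨fun f g => ⟨fun U => ∑ A ∈ U.powerset, f.val A * g.val (U \ A)⟩⟩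

theorem val_one (U : Finset V) : (1 : SetFun V R).val U = if U = ∅ then 1 else 0 := rfl
theorem val_mul (f g : SetFun V R) (U : Finset V) :
    (f * g).val U = ∑ A ∈ U.powerset, f.val A * g.val (U \ A) := rfl

protected theorem mul_comm (f g : SetFun V R) : f * g = g * f := by
  ext U
  rw [val_mul, val_mul]
  refine Finset.sum_bij' (fun A _ => U \ A) (fun A _ => U \ A) ?_ ?_ ?_ ?_ ?_
  · simp
  · simp
  · intro A hA; simpa using hA
  · intro A hA; simpa using hA
  · intro A hA
    rw [Finset.sdiff_sdiff_eq_self (Finset.mem_powerset.1 hA), mul_comm]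

protected theorem mul_assoc (f g h : SetFun V R) : f * g * h = f * (g * h) := by
  ext U
  simp only [val_mul, Finset.sum_mul, Finset.mul_sum]
  rw [Finset.sum_sigma', Finset.sum_sigma']
  refine Finset.sum_bij' (fun p _ => ⟨p.2, p.1 \ p.2⟩) (fun p _ => ⟨p.1 ∪ p.2, p.1⟩) ?_ ?_ ?_ ?_ ?_
  · rintro ⟨A, B⟩ h
    simp only [Finset.mem_sigma, Finset.mem_powerset] at h ⊢
    exact ⟨h.2.trans h.1, Finset.sdiff_subset_sdiff h.1 subset_rfl⟩
  · rintro ⟨A, B⟩ h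
    simp only [Finset.mem_sigma, Finset.mem_powerset] at h ⊢
    exact ⟨Finset.union_subset h.1 (h.2.trans Finset.sdiff_subset), Finset.subset_union_left⟩
  · rintro ⟨A, B⟩ h
    simp only [Finset.mem_sigma, Finset.mem_powerset] at h
    simp [Finset.union_sdiff_of_subset h.2]
  · rintro ⟨A, B⟩ h
    simp only [Finset.mem_sigma, Finset.mem_powerset] at h
    have : Disjoint A B := (Finset.subset_sdiff.1 h.2).2.symm
    simp [Finset.union_sdiff_cancel_left this]
  · rintro ⟨A, B⟩ h
    simp only [Finset.mem_sigma, Finset.mem_powerset] at h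
    have : (U \ B) \ (A \ B) = U \ A := by
      ext x
      have := @h.2 x
      simp only [Finset.mem_sdiff]
      tauto
    simp only [this, mul_assoc]

protected theorem one_mul (f : SetFun V R) : 1 * f = f := by
  ext U
  rw [val_mul, Finset.sum_eq_single ∅]
  · simp [val_one]
  · intro A _ hA; simp [val_one, hA]
  · simp

protected theorem add_mul (f g h : SetFun V R) : (f + g) * h = f * h + g * h := by
  ext U
  simp [val_mul, add_mul, Finset.sum_add_distrib]

instance : CommRing (SetFun V R) where
  add_assoc f g h := by ext; simp [add_assoc]
  zero_add f := by ext; simp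
  add_zero f := by ext; simp
  add_comm f g := by ext; simp [add_comm]
  neg_add_cancel f := by ext; simp
  mul_assoc := SetFun.mul_assoc
  mul_comm := SetFun.mul_comm
  one_mul := SetFun.one_mul
  mul_one f := by rw [SetFun.mul_comm, SetFun.one_mul]
  right_distrib := SetFun.add_mul
  left_distrib f g h := by
    rw [SetFun.mul_comm, SetFun.add_mul, SetFun.mul_comm g, SetFun.mul_comm h]
  zero_mul f := by ext; simp [val_mul]
  mul_zero f := by ext; simp [val_mul]
  nsmul := nsmulRec
  zsmul := zsmulRec

/-- Evaluation at a finite set, as an additive map. -/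
def valHom (U : Finset V) : SetFun V R →+ R where
  toFun f := f.val U
  map_zero' := rfl
  map_add' _ _ := rfl

theorem val_sum {ι : Type*} (s : Finset ι) (f : ι → SetFun V R) (U : Finset V) :
    (∑ k ∈ s, f k).val U = ∑ k ∈ s, (f k).val U :=
  map_sum (valHom U) f s

/-- Multiplication of all values by a scalar. -/
def scalar : R →+* SetFun V R where
  toFun r := ⟨fun U => if U = ∅ then r else 0⟩
  map_one' := rfl
  map_zero' := by ext; simp
  map_add' r s := by ext U; by_cases h : U = ∅ <;> simp [h]
  map_mul' r s := by
    ext U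
    rw [val_mul, Finset.sum_eq_single ∅]
    · simp
    · intro A _ hA; simp [hA]
    · simp

theorem val_scalar (r : R) (U : Finset V) :
    (scalar r : SetFun V R).val U = if U = ∅ then r else 0 := rfl

theorem val_scalar_mul (r : R) (f : SetFun V R) (U : Finset V) :
    (scalar r * f).val U = r * f.val U := by
  rw [val_mul, Finset.sum_eq_single ∅]
  · simp [scalar]
  · intro A _ hA; simp [scalar, hA]
  · simp

/-- Application of a ring homomorphism to all values. -/
def map (φ : R →+* S) : SetFun V R →+* SetFun V S where
  toFun f := ⟨fun U => φ (f.val U)⟩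
  map_one' := by ext U; simp [val_one, apply_ite φ]
  map_zero' := by ext; simp
  map_add' f g := by ext; simp
  map_mul' f g := by ext; simp [val_mul]

@[simp] theorem val_map (φ : R →+* S) (f : SetFun V R) (U : Finset V) :
    (map φ f).val U = φ (f.val U) := rfl

/-- The ring automorphism multiplying the value at `U` by `(-1) ^ |U|`. -/
def signed : SetFun V R →+* SetFun V R where
  toFun f := ⟨fun U => (-1) ^ U.card * f.val U⟩
  map_one' := by ext U; by_cases h : U = ∅ <;> simp [val_one, h]
  map_zero' := by ext; simp
  map_add' f g := by ext; simp [mul_add]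
  map_mul' f g := by
    ext U
    simp only [val_mul, Finset.mul_sum]
    refine Finset.sum_congr rfl fun A hA => ?_
    have h := Finset.card_sdiff_add_card_eq_card (Finset.mem_powerset.1 hA)
    rw [← h, pow_add]
    ring

theorem val_signed (f : SetFun V R) (U : Finset V) :
    (signed f).val U = (-1) ^ U.card * f.val U := rfl

theorem signed_signed (f : SetFun V R) : signed (signed f) = f := by
  ext U
  rw [val_signed, val_signed, ← mul_assoc, ← mul_pow]
  simp

/-- Restriction to the sets containing `v`. -/
def point (v : V) (f : SetFun V R) : SetFun V R := ⟨fun U => if v ∈ U then f.val U else 0⟩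

theorem val_point (v : V) (f : SetFun V R) (U : Finset V) :
    (point v f).val U = if v ∈ U then f.val U else 0 := rfl

theorem val_point_of_mem {v : V} {U : Finset V} (h : v ∈ U) (f : SetFun V R) :
    (point v f).val U = f.val U := if_pos h

theorem point_neg (v : V) (f : SetFun V R) : point v (-f) = -point v f := by
  ext U; by_cases h : v ∈ U <;> simp [val_point, h]

/-- A vertex of `U` lies in exactly one of `A` and `U \ A`, so `point v` is a derivation. -/
theorem point_mul (v : V) (f g : SetFun V R) :
    point v (f * g) = point v f * g + f * point v g := by
  ext U
  simp only [val_point, val_add, val_mul]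
  by_cases h : v ∈ U
  · rw [if_pos h, ← Finset.sum_add_distrib]
    refine Finset.sum_congr rfl fun A hA => ?_
    by_cases hv : v ∈ A <;> simp [h, hv]
  · rw [if_neg h, ← Finset.sum_add_distrib]
    refine (Finset.sum_eq_zero fun A hA => ?_).symm
    have : v ∉ A := fun hv => h (Finset.mem_powerset.1 hA hv)
    simp [h, this]

theorem point_scalar (v : V) (r : R) : point v (scalar r : SetFun V R) = 0 := by
  ext U
  rw [val_point]
  by_cases h : v ∈ U
  · have : U ≠ ∅ := by rintro rfl; simp at h
    simp [scalar, this]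
  · simp [h]

theorem point_one (v : V) : point v (1 : SetFun V R) = 0 := by
  rw [← map_one (scalar (V := V) (R := R)), point_scalar]

theorem point_pow_succ (v : V) (f : SetFun V R) (q : ℕ) :
    point v (f ^ (q + 1)) = scalar ((q : R) + 1) * (f ^ q * point v f) := by
  induction q with
  | zero => simp
  | succ q ih =>
    rw [pow_succ, point_mul, ih]
    push_cast
    rw [map_add (scalar (V := V) (R := R)) ((q : R) + 1) 1, map_one]
    ring

theorem point_map (v : V) (φ : R →+* S) (f : SetFun V R) :
    point v (map φ f) = map φ (point v f) := by
  ext U; by_cases h : v ∈ U <;> simp [val_point, h]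

theorem point_signed (v : V) (f : SetFun V R) :
    point v (signed f) = signed (point v f) := by
  ext U; by_cases h : v ∈ U <;> simp [val_point, val_signed, h]

/-- The function with value `r` at `A` and `0` elsewhere. -/
def single (A : Finset V) (r : R) : SetFun V R := ⟨fun U => if U = A then r else 0⟩

theorem sum_single [Fintype V] (f : SetFun V R) : f = ∑ A, single A (f.val A) := by
  ext U
  rw [val_sum]
  simp [single]

theorem single_mul_single (A B : Finset V) (r s : R) :
    single A r * single B s = if Disjoint A B then single (A ∪ B) (r * s) else 0 := by
  ext U
  rw [val_mul]
  have key : ∀ C ∈ U.powerset, (single A r).val C * (single B s).val (U \ C) =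
      if C = A then (if A ⊆ U ∧ U \ A = B then r * s else 0) else 0 := by
    intro C hC
    by_cases h : C = A
    · subst h
      by_cases h2 : U \ C = B <;> simp [single, h2, Finset.mem_powerset.1 hC]
    · simp [single, h]
  rw [Finset.sum_congr rfl key, Finset.sum_ite_eq']
  by_cases hd : Disjoint A B
  · rw [if_pos hd]
    have : (A ⊆ U ∧ U \ A = B) ↔ U = A ∪ B := by
      constructor
      · rintro ⟨h, rfl⟩
        rw [Finset.union_sdiff_of_subset h]
      · rintro rfl
        exact ⟨Finset.subset_union_left, Finset.union_sdiff_cancel_left hd⟩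
    simp only [this, single]
    by_cases h : U = A ∪ B
    · rw [if_pos (Finset.mem_powerset.2 (h ▸ Finset.subset_union_left)), if_pos h]
    · simp only [if_neg h, ite_self]
  · rw [if_neg hd]
    have : ¬ (A ⊆ U ∧ U \ A = B) := by
      rintro ⟨h, rfl⟩
      exact hd Finset.disjoint_sdiff
    simp [this]

open Classical in
theorem prod_single {ι : Type*} [DecidableEq ι] (s : Finset ι) (t : ι → Finset V) (r : ι → R) :
    ∏ k ∈ s, single (t k) (r k) =
      if (s : Set ι).PairwiseDisjoint t then single (s.biUnion t) (∏ k ∈ s, r k) else 0 := by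
  induction s using Finset.induction_on with
  | empty => simp; rfl
  | insert a s ha ih =>
    rw [Finset.prod_insert ha, ih]
    by_cases h : (s : Set ι).PairwiseDisjoint t
    · rw [if_pos h, single_mul_single, Finset.biUnion_insert, Finset.prod_insert ha]
      refine if_congr ?_ rfl rfl
      rw [Finset.coe_insert, Set.pairwiseDisjoint_insert_of_notMem (by simpa using ha),
        Finset.disjoint_biUnion_right]
      simp [h]
    · rw [if_neg h, if_neg, mul_zero]
      exact fun h' => h (h'.subset (by simp))

/-- The sets `t k` are pairwise disjoint and their union is `U`. -/
structure IsDecomposition {V ι : Type*} (t : ι → Finset V) (U : Finset V) : Prop where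
  disjoint : ∀ k l, k ≠ l → Disjoint (t k) (t l)
  cover : ∀ v, v ∈ U ↔ ∃ k, v ∈ t k

/-- The value of a product is a sum over the decompositions into pairwise disjoint sets. -/
theorem val_prod [Fintype V] {ι : Type*} [Fintype ι] (f : ι → SetFun V R) (U : Finset V)
    [Fintype {t : ι → Finset V // IsDecomposition t U}] :
    (∏ k, f k).val U =
      ∑ t : {t : ι → Finset V // IsDecomposition t U}, ∏ k, (f k).val (t.1 k) := by
  classical
  have h1 : ∏ k, f k = ∑ t : ι → Finset V, ∏ k, single (t k) ((f k).val (t k)) := by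
    conv_lhs => rw [Finset.prod_congr rfl fun k _ => sum_single (f k)]
    rw [Finset.prod_univ_sum, Fintype.piFinset_univ]
  rw [h1, val_sum, ← Finset.sum_subtype (Finset.univ.filter fun t : ι → Finset V =>
    IsDecomposition t U) (by simp) (fun t => ∏ k, (f k).val (t k)), Finset.sum_filter]
  refine Finset.sum_congr rfl fun t _ => ?_
  rw [prod_single]
  have key : IsDecomposition t U ↔ ((Finset.univ : Finset ι) : Set ι).PairwiseDisjoint t ∧
      U = Finset.univ.biUnion t := by
    constructor
    · intro h
      refine ⟨fun k _ l _ hkl => h.disjoint k l hkl, ?_⟩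
      ext v
      rw [h.cover]
      simp
    · rintro ⟨h, rfl⟩
      exact ⟨fun k l hkl => h (by simp) (by simp) hkl, fun v => by simp⟩
  by_cases h : ((Finset.univ : Finset ι) : Set ι).PairwiseDisjoint t
  · simp only [key, h, if_true, true_and, single]
  · simp only [key, h, if_false, false_and, val_zero]

end SetFun

/-! ### Acyclic orientations, sources and independent sets -/

section AcyclicOrientations

variable {V : Type*} (G : SimpleGraph V)

/-- The relation `r` is the arc relation of an acyclic orientation of the subgraph of `G` induced
by `U`. -/
structure IsAcyclicArcs (U : Finset V) (r : V → V → Prop) : Prop where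
  arc_iff : ∀ u v, (r u v ∨ r v u) ↔ u ∈ U ∧ v ∈ U ∧ G.Adj u v
  acyclic : ∀ v, ¬ Relation.TransGen r v v

/-- No two elements of `U` are adjacent. -/
def IsIndepFinset (U : Finset V) : Prop := ∀ u ∈ U, ∀ v ∈ U, ¬ G.Adj u v

/-- The vertex `v` belongs to `U` and is the only source of the relation `r` on `U`. -/
def IsUniqueSource (U : Finset V) (v : V) (r : V → V → Prop) : Prop :=
  v ∈ U ∧ ∀ w ∈ U, (∀ u, ¬ r u w) ↔ w = v

variable {G} {U A B : Finset V} {r : V → V → Prop}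

namespace IsAcyclicArcs

theorem mem_left (h : IsAcyclicArcs G U r) {u v : V} (huv : r u v) : u ∈ U :=
  ((h.arc_iff u v).1 (Or.inl huv)).1

theorem mem_right (h : IsAcyclicArcs G U r) {u v : V} (huv : r u v) : v ∈ U :=
  ((h.arc_iff u v).1 (Or.inl huv)).2.1

theorem adj (h : IsAcyclicArcs G U r) {u v : V} (huv : r u v) : G.Adj u v :=
  ((h.arc_iff u v).1 (Or.inl huv)).2.2

theorem asymm (h : IsAcyclicArcs G U r) {u v : V} (huv : r u v) : ¬ r v u :=
  fun hvu => h.acyclic u (.tail (.single huv) hvu)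

theorem wellFounded [Finite V] (h : IsAcyclicArcs G U r) : WellFounded r := by
  have : IsTrans V (Relation.TransGen r) := ⟨fun _ _ _ => Relation.TransGen.trans⟩
  have : Std.Irrefl (Relation.TransGen r) := ⟨h.acyclic⟩
  exact Subrelation.wf (fun {x y} => Relation.TransGen.single)
    (Finite.wellFounded_of_trans_of_irrefl (Relation.TransGen r))

theorem exists_source [Finite V] (h : IsAcyclicArcs G U r) (hU : U.Nonempty) :
    ∃ v ∈ U, ∀ u, ¬ r u v := by
  obtain ⟨v, hv, hmin⟩ := h.wellFounded.has_min (U : Set V) hU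
  exact ⟨v, hv, fun u hu => hmin u (h.mem_left hu) hu⟩

/-- Restriction to a subset. -/
theorem restrict (h : IsAcyclicArcs G U r) (hA : A ⊆ U) :
    IsAcyclicArcs G A (fun u v => u ∈ A ∧ v ∈ A ∧ r u v) where
  arc_iff u v := by
    constructor
    · rintro (⟨hu, hv, h'⟩ | ⟨hv, hu, h'⟩)
      · exact ⟨hu, hv, h.adj h'⟩
      · exact ⟨hu, hv, (h.adj h').symm⟩
    · rintro ⟨hu, hv, h'⟩
      rcases (h.arc_iff u v).2 ⟨hA hu, hA hv, h'⟩ with h1 | h1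
      · exact Or.inl ⟨hu, hv, h1⟩
      · exact Or.inr ⟨hv, hu, h1⟩
  acyclic v hv := h.acyclic v (Relation.TransGen.mono (fun _ _ h => h.2.2) _ _ hv)

/-- Orientations of two disjoint parts are joined by directing all edges between them from the
first part to the second. -/
theorem join [DecidableEq V] {s : V → V → Prop} (hr : IsAcyclicArcs G A r)
    (hs : IsAcyclicArcs G B s) (hAB : Disjoint A B) :
    IsAcyclicArcs G (A ∪ B) (fun u v => r u v ∨ s u v ∨ (u ∈ A ∧ v ∈ B ∧ G.Adj u v)) where
  arc_iff u v := by
    have h1 := hr.arc_iff u v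
    have h2 := hs.arc_iff u v
    have h3 := G.adj_comm u v
    simp only [Finset.mem_union]
    tauto
  acyclic v hv := by
    have hnot : ∀ x, x ∈ A → x ∉ B := fun x hx => Finset.disjoint_left.1 hAB hx
    -- No arc leads from `B` to `A`, so a path that starts in `B` or ends in `A` stays inside that
    -- part; a closed path would be a cycle of `r` or of `s`.
    have key : ∀ x y, Relation.TransGen
        (fun u v => r u v ∨ s u v ∨ (u ∈ A ∧ v ∈ B ∧ G.Adj u v)) x y →
        (x ∈ B → y ∈ B ∧ Relation.TransGen s x y) ∧
        (y ∈ A → x ∈ A ∧ Relation.TransGen r x y) ∧ (x ∈ A ∪ B) := by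
      intro x y h
      induction h with
      | single h =>
        rcases h with h | h | ⟨h, h', -⟩
        · exact ⟨fun hx => absurd hx (hnot _ (hr.mem_left h)),
            fun _ => ⟨hr.mem_left h, .single h⟩, Finset.mem_union_left _ (hr.mem_left h)⟩
        · exact ⟨fun _ => ⟨hs.mem_right h, .single h⟩,
            fun hy => absurd (hs.mem_right h) (hnot _ hy), Finset.mem_union_right _ (hs.mem_left h)⟩
        · exact ⟨fun hx => absurd hx (hnot _ h), fun hy => absurd h' (hnot _ hy),
            Finset.mem_union_left _ h⟩
      | tail _ h ih =>
        refine ⟨fun hx => ?_, fun hy => ?_, ih.2.2⟩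
        · obtain ⟨hb, ht⟩ := ih.1 hx
          rcases h with h | h | ⟨h, h', -⟩
          · exact absurd hb (hnot _ (hr.mem_left h))
          · exact ⟨hs.mem_right h, ht.tail h⟩
          · exact absurd hb (hnot _ h)
        · rcases h with h | h | ⟨h, h', -⟩
          · obtain ⟨ha, ht⟩ := ih.2.1 (hr.mem_left h)
            exact ⟨ha, ht.tail h⟩
          · exact absurd (hs.mem_right h) (hnot _ hy)
          · exact absurd h' (hnot _ hy)
    obtain ⟨h1, h2, h3⟩ := key v v hv
    rcases Finset.mem_union.1 h3 with h | h
    · exact hr.acyclic v (h2 h).2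
    · exact hs.acyclic v (h1 h).2

end IsAcyclicArcs

/-- Acyclic orientations in which no arc leaves `B` correspond to pairs of acyclic orientations of
the complement of `B` and of `B`. -/
def acyclicArcsEquivProd [DecidableEq V] (hB : B ⊆ U) :
    {r // IsAcyclicArcs G U r ∧ ∀ u v, r u v → u ∈ B → v ∈ B} ≃
      {r // IsAcyclicArcs G (U \ B) r} × {r // IsAcyclicArcs G B r} where
  toFun r := ⟨⟨_, r.2.1.restrict Finset.sdiff_subset⟩, ⟨_, r.2.1.restrict hB⟩⟩
  invFun p := ⟨fun u v => p.1.1 u v ∨ p.2.1 u v ∨ (u ∈ U \ B ∧ v ∈ B ∧ G.Adj u v), by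
    refine ⟨?_, ?_⟩
    · have := p.1.2.join p.2.2 Finset.sdiff_disjoint
      rwa [Finset.sdiff_union_of_subset hB] at this
    · rintro u v (h | h | h) hu
      · exact absurd hu (Finset.mem_sdiff.1 (p.1.2.mem_left h)).2
      · exact p.2.2.mem_right h
      · exact h.2.1⟩
  left_inv r := by
    obtain ⟨r, hr, hc⟩ := r
    refine Subtype.ext ?_
    funext u v
    refine propext ⟨?_, fun h => ?_⟩
    · rintro (h | h | ⟨hu, hv, h⟩)
      · exact h.2.2
      · exact h.2.2
      · rcases (hr.arc_iff u v).2 ⟨(Finset.mem_sdiff.1 hu).1, hB hv, h⟩ with h | h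
        · exact h
        · exact absurd (hc v u h hv) (Finset.mem_sdiff.1 hu).2
    · have h1 := hr.mem_left h
      have h2 := hr.mem_right h
      have h3 := hr.adj h
      have h4 := hc u v h
      simp only [Finset.mem_sdiff]
      tauto
  right_inv p := by
    obtain ⟨⟨r, hr⟩, ⟨s, hs⟩⟩ := p
    refine Prod.ext (Subtype.ext ?_) (Subtype.ext ?_) <;> funext u v <;> refine propext ?_
    · have h1 := fun h : r u v => hr.mem_left h
      have h2 := fun h : r u v => hr.mem_right h
      have h3 := fun h : s u v => hs.mem_left h
      have h4 := fun h : s u v => hs.mem_right h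
      simp only [Finset.mem_sdiff] at *
      tauto
    · have h1 := fun h : r u v => hr.mem_left h
      have h2 := fun h : r u v => hr.mem_right h
      have h3 := fun h : s u v => hs.mem_left h
      have h4 := fun h : s u v => hs.mem_right h
      simp only [Finset.mem_sdiff] at *
      tauto

theorem isAcyclicArcs_iff_of_isIndepFinset (hU : IsIndepFinset G U) (r : V → V → Prop) :
    IsAcyclicArcs G U r ↔ r = fun _ _ => False := by
  constructor
  · intro h
    funext u v
    exact eq_false fun h' => hU u (h.mem_left h') v (h.mem_right h') (h.adj h')
  · rintro rfl
    refine ⟨fun u v => ⟨by simp, fun h => absurd h.2.2 (hU u h.1 v h.2.1)⟩, fun v hv => ?_⟩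
    obtain ⟨w, _, h⟩ := Relation.TransGen.tail'_iff.1 hv
    exact h

theorem isIndepFinset_of_forall_source (h : IsAcyclicArcs G U r) (hA : A ⊆ U)
    (hs : ∀ v ∈ A, ∀ u, ¬ r u v) : IsIndepFinset G A := by
  intro u hu v hv hadj
  rcases (h.arc_iff u v).2 ⟨hA hu, hA hv, hadj⟩ with h' | h'
  · exact hs v hv u h'
  · exact hs u hu v h'

/-- If no arc leaves `B`, then `B` consists of the vertices reachable from `v` exactly if `v` is
the unique source of the restriction to `B`. -/
theorem reachable_iff_isUniqueSource [Finite V] (h : IsAcyclicArcs G U r)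
    (hc : ∀ u v, r u v → u ∈ B → v ∈ B) (v : V) :
    (∀ w, w ∈ B ↔ Relation.ReflTransGen r v w) ↔
      IsUniqueSource B v (fun x y => x ∈ B ∧ y ∈ B ∧ r x y) := by
  constructor
  · intro hr
    refine ⟨(hr v).2 .refl, fun w hw => ⟨fun hs => ?_, ?_⟩⟩
    · rcases Relation.ReflTransGen.cases_tail ((hr w).1 hw) with h' | ⟨u, hu, huw⟩
      · exact h'
      · exact absurd ⟨(hr u).2 hu, hw, huw⟩ (hs u)
    · rintro rfl u ⟨hu, -, huw⟩
      exact h.acyclic w (.tail' ((hr u).1 hu) huw)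
  · rintro ⟨hv, hs⟩ w
    constructor
    · intro hw
      -- A vertex of `B` other than `v` is no source, so it can be traced back along arcs within
      -- `B`; by well-foundedness this ends at `v`.
      induction w using h.wellFounded.induction with
      | _ w ih =>
        by_cases hwv : w = v
        · rw [hwv]
        · have := mt (hs w hw).1 hwv
          push Not at this
          obtain ⟨u, hu, -, huw⟩ := this
          exact (ih u huw hu).tail huw
    · intro hr
      induction hr with
      | refl => exact hv
      | tail _ h' ih => exact hc _ _ h' ih

variable (G)

/-- The indicator function of the independent sets. -/
noncomputable def indepFun : SetFun V ℤ := by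
  classical exact ⟨fun U => if IsIndepFinset G U then 1 else 0⟩

/-- The number of acyclic orientations of the subgraph induced by a set. -/
noncomputable def acyclicFun : SetFun V ℤ := ⟨fun U => Nat.card {r // IsAcyclicArcs G U r}⟩

/-- The number of acyclic orientations, of the subgraph induced by a set, with unique source `v`. -/
noncomputable def sourceFun (v : V) : SetFun V ℤ :=
  ⟨fun U => Nat.card {r // IsAcyclicArcs G U r ∧ IsUniqueSource U v r}⟩

variable [DecidableEq V]

/-- For independent `S`, all of `S` being sources means that no arc leaves `U \ S`; such an
orientation is determined by its restriction to `U \ S`, since `S` carries no edges. -/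
theorem card_acyclicArcs_forall_source {S : Finset V} (hS : S ⊆ U) (hI : IsIndepFinset G S) :
    Nat.card {r // IsAcyclicArcs G U r ∧ ∀ v ∈ S, ∀ u, ¬ r u v} =
      Nat.card {r // IsAcyclicArcs G (U \ S) r} := by
  have h1 : ∀ r : V → V → Prop, (IsAcyclicArcs G U r ∧ ∀ v ∈ S, ∀ u, ¬ r u v) ↔
      (IsAcyclicArcs G U r ∧ ∀ u v, r u v → u ∈ U \ S → v ∈ U \ S) := by
    intro r
    refine and_congr_right fun hr => ⟨fun h u v huv _ => ?_, fun h v hv u huv => ?_⟩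
    · exact Finset.mem_sdiff.2 ⟨hr.mem_right huv, fun hv => h v hv u huv⟩
    · by_cases hu : u ∈ S
      · exact hI u hu v hv (hr.adj huv)
      · exact (Finset.mem_sdiff.1 (h u v huv (Finset.mem_sdiff.2 ⟨hr.mem_left huv, hu⟩))).2 hv
  rw [Nat.card_congr (Equiv.subtypeEquivRight h1),
    Nat.card_congr (acyclicArcsEquivProd Finset.sdiff_subset), Nat.card_prod,
    Finset.sdiff_sdiff_eq_self hS,
    Nat.card_congr (Equiv.subtypeEquivRight (isAcyclicArcs_iff_of_isIndepFinset hI))]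
  simp

variable [Fintype V]

theorem card_acyclicArcs_reachable (hB : B ⊆ U) (v : V) :
    Nat.card {r // IsAcyclicArcs G U r ∧ ∀ w, w ∈ B ↔ Relation.ReflTransGen r v w} =
      Nat.card {r // IsAcyclicArcs G B r ∧ IsUniqueSource B v r} *
        Nat.card {r // IsAcyclicArcs G (U \ B) r} := by
  have h1 : ∀ r : V → V → Prop,
      (IsAcyclicArcs G U r ∧ ∀ w, w ∈ B ↔ Relation.ReflTransGen r v w) ↔
      ((IsAcyclicArcs G U r ∧ ∀ x y, r x y → x ∈ B → y ∈ B) ∧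
        ∀ w, w ∈ B ↔ Relation.ReflTransGen r v w) :=
    fun r => ⟨fun h => ⟨⟨h.1, fun x y hxy hx => (h.2 y).2 (((h.2 x).1 hx).tail hxy)⟩, h.2⟩,
      fun h => ⟨h.1.1, h.2⟩⟩
  let e : {r // IsAcyclicArcs G U r ∧ ∀ w, w ∈ B ↔ Relation.ReflTransGen r v w} ≃
      {p : {r // IsAcyclicArcs G B r} × {r // IsAcyclicArcs G (U \ B) r} //
        IsUniqueSource B v p.1.1} :=
    (Equiv.subtypeEquivRight h1).trans <| (Equiv.subtypeSubtypeEquivSubtypeInter _ _).symm.trans <|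
      ((acyclicArcsEquivProd hB).trans (Equiv.prodComm _ _)).subtypeEquiv fun r =>
        reachable_iff_isUniqueSource r.2.1 r.2.2 v
  rw [Nat.card_congr (e.trans (Equiv.prodSubtypeFstEquivSubtypeProd
    (p := fun s : {r // IsAcyclicArcs G B r} => IsUniqueSource B v s.1))), Nat.card_prod,
    Nat.card_congr (Equiv.subtypeSubtypeEquivSubtypeInter (IsAcyclicArcs G B)
      (IsUniqueSource B v))]

/-- The product counts pairs of an acyclic orientation of `U` and a set `S` of its sources, with
sign `(-1) ^ |S|`. For a fixed orientation the signs cancel unless there is no source, which happens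
only for `U = ∅`. -/
theorem signed_indepFun_mul_acyclicFun : SetFun.signed (indepFun G) * acyclicFun G = 1 := by
  classical
  ext U
  rw [SetFun.val_mul, SetFun.val_one]
  have key : ∀ S ∈ U.powerset, (SetFun.signed (indepFun G)).val S * (acyclicFun G).val (U \ S) =
      ∑ r : {r // IsAcyclicArcs G U r}, if ∀ v ∈ S, ∀ u, ¬ r.1 u v then (-1) ^ S.card else 0 := by
    intro S hS
    have hSU := Finset.mem_powerset.1 hS
    rw [SetFun.val_signed, ← Finset.sum_filter, Finset.sum_const, nsmul_eq_mul,
      ← Fintype.card_subtype, ← Nat.card_eq_fintype_card,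
      Nat.card_congr (Equiv.subtypeSubtypeEquivSubtypeInter (IsAcyclicArcs G U)
        (fun r => ∀ v ∈ S, ∀ u, ¬ r u v))]
    by_cases hI : IsIndepFinset G S
    · rw [card_acyclicArcs_forall_source G hSU hI]
      simp [indepFun, acyclicFun, hI, mul_comm]
    -- Two adjacent vertices cannot both be sources, so for dependent `S` both sides vanish.
    · have : IsEmpty {r // IsAcyclicArcs G U r ∧ ∀ v ∈ S, ∀ u, ¬ r u v} :=
        ⟨fun r => hI (isIndepFinset_of_forall_source r.2.1 hSU r.2.2)⟩
      simp [indepFun, hI]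
  rw [Finset.sum_congr rfl key, Finset.sum_comm]
  have key2 : ∀ r : {r // IsAcyclicArcs G U r},
      (∑ S ∈ U.powerset, if ∀ v ∈ S, ∀ u, ¬ r.1 u v then (-1 : ℤ) ^ S.card else 0) =
        if U = ∅ then 1 else 0 := by
    intro r
    rw [← Finset.sum_filter]
    have : U.powerset.filter (fun S => ∀ v ∈ S, ∀ u, ¬ r.1 u v) =
        (U.filter fun v => ∀ u, ¬ r.1 u v).powerset := by
      ext S
      simp only [Finset.mem_filter, Finset.mem_powerset, Finset.subset_iff]
      grind
    rw [this, Finset.sum_powerset_neg_one_pow_card]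
    refine if_congr ⟨fun h => ?_, fun h => by simp [h]⟩ rfl rfl
    by_contra hU
    obtain ⟨v, hv, hs⟩ := r.2.exists_source (Finset.nonempty_iff_ne_empty.2 hU)
    have : v ∈ (∅ : Finset V) := h ▸ Finset.mem_filter.2 ⟨hv, hs⟩
    simp at this
  rw [Finset.sum_congr rfl fun r _ => key2 r, Finset.sum_const, nsmul_eq_mul]
  by_cases hU : U = ∅
  · subst hU
    rw [Finset.card_univ, ← Nat.card_eq_fintype_card, Nat.card_congr (Equiv.subtypeEquivRight
      (isAcyclicArcs_iff_of_isIndepFinset (by simp [IsIndepFinset])))]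
    simp
  · simp [hU]

/-- Acyclic orientations of `U` are sorted by the set `B` of vertices reachable from `v`: inside `B`
the only source is `v`, and all edges between `U \ B` and `B` are forced to point into `B`. -/
theorem point_acyclicFun (v : V) :
    SetFun.point v (acyclicFun G) = sourceFun G v * acyclicFun G := by
  classical
  ext U
  rw [SetFun.val_point, SetFun.val_mul]
  have key : ∀ B ∈ U.powerset, (sourceFun G v).val B * (acyclicFun G).val (U \ B) =
      (Nat.card {r // IsAcyclicArcs G U r ∧ ∀ w, w ∈ B ↔ Relation.ReflTransGen r v w} : ℤ) := by
    intro B hB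
    rw [card_acyclicArcs_reachable G (Finset.mem_powerset.1 hB)]
    simp [sourceFun, acyclicFun]
  rw [Finset.sum_congr rfl key]
  by_cases hv : v ∈ U
  · rw [if_pos hv]
    change (Nat.card {r // IsAcyclicArcs G U r} : ℤ) = _
    rw [Nat.card_eq_fintype_card, ← Finset.card_univ,
      Finset.card_eq_sum_card_fiberwise (t := U.powerset)
        (f := fun r : {r // IsAcyclicArcs G U r} => U.filter (Relation.ReflTransGen r.1 v))
        (fun r _ => Finset.mem_powerset.2 (Finset.filter_subset _ _)), Nat.cast_sum]
    refine Finset.sum_congr rfl fun B hB => ?_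
    rw [← Fintype.card_subtype, ← Nat.card_eq_fintype_card, Nat.card_congr
      (Equiv.subtypeSubtypeEquivSubtypeInter (IsAcyclicArcs G U)
        (fun r => U.filter (Relation.ReflTransGen r v) = B))]
    congr 1
    refine Nat.card_congr (Equiv.subtypeEquivRight fun r => and_congr_right fun hr => ?_)
    have hU : ∀ w, Relation.ReflTransGen r v w → w ∈ U := by
      intro w hw
      rcases Relation.ReflTransGen.cases_tail hw with rfl | ⟨u, -, huw⟩
      · exact hv
      · exact hr.mem_right huw
    rw [Finset.ext_iff]
    refine forall_congr' fun w => ?_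
    rw [Finset.mem_filter]
    have := hU w
    tauto
  · rw [if_neg hv]
    refine (Finset.sum_eq_zero fun B hB => ?_).symm
    have : IsEmpty {r // IsAcyclicArcs G U r ∧ ∀ w, w ∈ B ↔ Relation.ReflTransGen r v w} :=
      ⟨fun r => hv (Finset.mem_powerset.1 hB ((r.2.2 v).2 .refl))⟩
    simp

/-- The signed number of acyclic orientations with unique source `v`. -/
noncomputable def signedSourceFun (v : V) : SetFun V ℤ := -SetFun.signed (sourceFun G v)

theorem indepFun_mul_signed_acyclicFun : indepFun G * SetFun.signed (acyclicFun G) = 1 := by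
  have := congrArg SetFun.signed (signed_indepFun_mul_acyclicFun G)
  rwa [map_mul, SetFun.signed_signed, map_one] at this

theorem point_indepFun (v : V) :
    SetFun.point v (indepFun G) = signedSourceFun G v * indepFun G := by
  have h1 := indepFun_mul_signed_acyclicFun G
  have h2 := congrArg (SetFun.point v) h1
  rw [SetFun.point_mul, SetFun.point_one, SetFun.point_signed, point_acyclicFun, map_mul] at h2
  rw [signedSourceFun]
  -- The differentiated identity is multiplied by `indepFun G`, and `h1` cancels the inverse pair.
  linear_combination indepFun G * h2 + (-SetFun.point v (indepFun G) -
    indepFun G * SetFun.signed (sourceFun G v)) * h1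

end AcyclicOrientations

/-! ### Set functions with polynomial values -/

namespace SetFun

variable {V : Type*}

/-- The derivative of all values. -/
noncomputable def formalDeriv (f : SetFun V ℤ[X]) : SetFun V ℤ[X] := ⟨fun U => derivative (f.val U)⟩

theorem val_formalDeriv (f : SetFun V ℤ[X]) (U : Finset V) :
    (formalDeriv f).val U = derivative (f.val U) := rfl

theorem val_iterate_formalDeriv (f : SetFun V ℤ[X]) (i : ℕ) (U : Finset V) :
    (formalDeriv^[i] f).val U = derivative^[i] (f.val U) := by
  induction i with
  | zero => rfl
  | succ i ih => rw [Function.iterate_succ_apply', Function.iterate_succ_apply', val_formalDeriv, ih]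

variable [DecidableEq V]

/-- Restriction to the sets containing `T`. -/
def pointSet {R : Type*} [CommRing R] (T : Finset V) (f : SetFun V R) : SetFun V R :=
  ⟨fun U => if T ⊆ U then f.val U else 0⟩

theorem pointSet_insert {R : Type*} [CommRing R] (v : V) (T : Finset V) (f : SetFun V R) :
    pointSet (insert v T) f = point v (pointSet T f) := by
  ext U
  simp only [pointSet, val_point, Finset.insert_subset_iff, ite_and]

/-- Evaluation of all values at an integer. -/
noncomputable def evalAt (x : ℤ) : SetFun V ℤ[X] →+* SetFun V ℤ := map (evalRingHom x)

/-- Substitution of `X + c` in all values. -/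
noncomputable def shift (c : ℤ) : SetFun V ℤ[X] →+* SetFun V ℤ[X] := map (compRingHom (X + C c))

/-- Integers as constant polynomials. -/
noncomputable def const : SetFun V ℤ →+* SetFun V ℤ[X] := map C

theorem val_evalAt (x : ℤ) (f : SetFun V ℤ[X]) (U : Finset V) :
    (evalAt x f).val U = (f.val U).eval x := rfl

theorem val_const (f : SetFun V ℤ) (U : Finset V) : (const f).val U = C (f.val U) := rfl

@[simp] theorem evalAt_const (x : ℤ) (f : SetFun V ℤ) : evalAt x (const f) = f := by
  ext U
  rw [val_evalAt, val_const, eval_C]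

theorem evalAt_scalar (x : ℤ) (p : ℤ[X]) :
    evalAt x (scalar p : SetFun V ℤ[X]) = scalar (p.eval x) := by
  ext U
  rw [val_evalAt, val_scalar, val_scalar]
  by_cases h : U = ∅ <;> simp [h]

theorem const_scalar (r : ℤ) : const (scalar r : SetFun V ℤ) = scalar (C r) := by
  ext1
  funext U
  rw [val_const, val_scalar, val_scalar]
  by_cases h : U = ∅ <;> simp [h]

theorem evalAt_shift (x c : ℤ) (f : SetFun V ℤ[X]) :
    evalAt x (shift c f) = evalAt (x + c) f := by
  ext U
  simp [val_evalAt, shift]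

theorem point_const (v : V) (f : SetFun V ℤ) : point v (const f) = const (point v f) :=
  point_map v C f

theorem point_evalAt (v : V) (x : ℤ) (f : SetFun V ℤ[X]) :
    point v (evalAt x f) = evalAt x (point v f) :=
  point_map v _ f

theorem eq_of_evalAt (m : ℕ) {f g : SetFun V ℤ[X]}
    (h : ∀ q : ℕ, m < q → evalAt (q : ℤ) f = evalAt (q : ℤ) g) : f = g := by
  ext1
  funext U
  refine Polynomial.eq_of_infinite_eval_eq _ _ ?_
  refine Set.Infinite.mono (s := Set.range fun k : ℕ => ((m + 1 + k : ℕ) : ℤ)) ?_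
    (Set.infinite_range_of_injective fun a b hab => by simpa using hab)
  rintro _ ⟨k, rfl⟩
  exact congrArg (fun f => SetFun.val f U) (h (m + 1 + k) (by omega))

theorem formalDeriv_mul (f g : SetFun V ℤ[X]) :
    formalDeriv (f * g) = formalDeriv f * g + f * formalDeriv g := by
  ext1
  funext U
  simp only [val_formalDeriv, val_mul, val_add, derivative_sum, derivative_mul, Finset.sum_add_distrib]

theorem formalDeriv_const (f : SetFun V ℤ) : formalDeriv (const f) = 0 := by
  ext1
  funext U
  rw [val_formalDeriv, val_const, derivative_C, val_zero]

theorem formalDeriv_scalar_X : formalDeriv (scalar X : SetFun V ℤ[X]) = 1 := by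
  ext1
  funext U
  by_cases h : U = ∅ <;> simp [val_formalDeriv, scalar, val_one, h]

theorem formalDeriv_shift (c : ℤ) (f : SetFun V ℤ[X]) :
    formalDeriv (shift c f) = shift c (formalDeriv f) := by
  ext1
  funext U
  simp [val_formalDeriv, shift, derivative_comp]

theorem point_formalDeriv (v : V) (f : SetFun V ℤ[X]) :
    point v (formalDeriv f) = formalDeriv (point v f) := by
  ext1
  funext U
  by_cases h : v ∈ U <;> simp [val_point, val_formalDeriv, h]

end SetFun

/-! ### Chromatic polynomials as powers in the ring of set functions -/

section Chromatic

open SetFun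

variable {V : Type*} [Fintype V] (G : SimpleGraph V)

/-- The chromatic polynomials of the induced subgraphs. -/
noncomputable def chromaticFun : SetFun V ℤ[X] :=
  ⟨fun U => chromaticPoly (G.induce (U : Set V))⟩

theorem val_chromaticFun_univ : (chromaticFun G).val Finset.univ = chromaticPoly G := by
  refine eq_chromaticPoly G _ fun q hq => ?_
  refine (chromaticPoly_eval _ q hq).trans ?_
  congr 1
  refine Nat.card_congr
    { toFun := fun c => SimpleGraph.Coloring.mk (fun v => c ⟨v, by simp⟩)
        fun {v w} h => c.valid (by simpa using h)
      invFun := fun c => SimpleGraph.Coloring.mk (fun v => c v)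
        fun {v w} h => c.valid (by simpa using h)
      left_inv := fun c => rfl
      right_inv := fun c => rfl }

theorem val_chromaticFun_empty : (chromaticFun G).val ∅ = 1 := by
  refine (eq_chromaticPoly _ 1 fun q _ => ?_).symm
  have : IsEmpty (((∅ : Finset V) : Set V) : Type _) := by simp
  have h : Nat.card ((G.induce ((∅ : Finset V) : Set V)).Coloring (Fin q)) = 1 := by
    rw [Nat.card_eq_one_iff_unique]
    exact ⟨⟨fun a b => by ext v; exact isEmptyElim v⟩,
      ⟨SimpleGraph.Coloring.mk isEmptyElim fun {v} => isEmptyElim v⟩⟩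
  rw [h]
  simp

variable [DecidableEq V]

/-- Proper colorings of an induced subgraph correspond to decompositions into independent sets. -/
noncomputable def coloringEquivDecomposition (U : Finset V) (q : ℕ) :
    (G.induce (U : Set V)).Coloring (Fin q) ≃
      {t : {t : Fin q → Finset V // IsDecomposition t U} // ∀ k, IsIndepFinset G (t.1 k)} := by
  classical
  refine Equiv.ofBijective (fun c => ⟨⟨fun k => Finset.univ.filter fun v =>
    ∃ h : v ∈ U, c ⟨v, h⟩ = k, ?_, ?_⟩, ?_⟩) ⟨?_, ?_⟩
  · intro k l hkl
    refine Finset.disjoint_left.2 fun v hv hv' => hkl ?_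
    obtain ⟨-, h, rfl⟩ := Finset.mem_filter.1 hv
    obtain ⟨-, _, rfl⟩ := Finset.mem_filter.1 hv'
    rfl
  · intro v
    simp
  · intro k u hu v hv huv
    obtain ⟨-, h, hk⟩ := Finset.mem_filter.1 hu
    obtain ⟨-, h', hk'⟩ := Finset.mem_filter.1 hv
    exact c.valid (v := ⟨u, h⟩) (w := ⟨v, h'⟩) huv (hk.trans hk'.symm)
  · intro c c' h
    ext ⟨v, hv⟩
    have h1 := congrFun (congrArg (fun t => t.1.1) h) (c ⟨v, hv⟩)
    have h2 := (Finset.ext_iff.1 h1 v).1 (Finset.mem_filter.2 ⟨Finset.mem_univ _, hv, rfl⟩)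
    obtain ⟨-, _, h3⟩ := Finset.mem_filter.1 h2
    rw [← h3]
  · rintro ⟨⟨t, ht⟩, hI⟩
    choose f hf using fun v : (U : Set V) => (ht.cover v).1 v.2
    have huniq : ∀ (v : (U : Set V)) k, (v : V) ∈ t k → f v = k := by
      intro v k hk
      by_contra hne
      exact Finset.disjoint_left.1 (ht.disjoint _ _ hne) (hf v) hk
    refine ⟨SimpleGraph.Coloring.mk f fun {u v} huv heq =>
      hI (f u) u (hf u) v (heq ▸ hf v) huv, ?_⟩
    refine Subtype.ext (Subtype.ext ?_)
    funext k
    ext v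
    simp only [Finset.mem_filter, Finset.mem_univ, true_and]
    constructor
    · rintro ⟨h, rfl⟩
      exact hf ⟨v, h⟩
    · intro hv
      have hU : v ∈ U := (ht.cover v).2 ⟨k, hv⟩
      exact ⟨hU, huniq ⟨v, hU⟩ k hv⟩

theorem evalAt_chromaticFun_natCast (q : ℕ) (hq : 0 < q) :
    evalAt (q : ℤ) (chromaticFun G) = indepFun G ^ q := by
  classical
  ext U
  rw [val_evalAt]
  refine (chromaticPoly_eval _ q hq).trans ?_
  have : Fintype {t : Fin q → Finset V // IsDecomposition t U} := Fintype.ofFinite _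
  rw [Nat.card_congr (coloringEquivDecomposition G U q)]
  have h := val_prod (fun _ : Fin q => indepFun G) U
  rw [Finset.prod_const, Finset.card_univ, Fintype.card_fin] at h
  rw [h, Nat.card_eq_fintype_card, Fintype.card_subtype, Finset.card_filter, Nat.cast_sum]
  refine Finset.sum_congr rfl fun t _ => ?_
  simp only [indepFun, Finset.prod_ite_zero, Finset.mem_univ, true_imp_iff, Finset.prod_const_one,
    Nat.cast_ite, Nat.cast_one, Nat.cast_zero]

theorem indepFun_pow_mul_signed_acyclicFun_pow (q j : ℕ) :
    indepFun G ^ (q + j) * signed (acyclicFun G) ^ j = indepFun G ^ q := by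
  rw [pow_add, mul_assoc, ← mul_pow, indepFun_mul_signed_acyclicFun, one_pow, mul_one]

/-- Multiplying by a power of the inverse of `indepFun G` lowers the argument. This is known for
large `q`, hence is a polynomial identity, and may be read off at a small argument. -/
theorem evalAt_chromaticFun_neg (j : ℕ) :
    evalAt (-(j : ℤ)) (chromaticFun G) = signed (acyclicFun G) ^ j := by
  have h : chromaticFun G * const (signed (acyclicFun G) ^ (j + 1)) =
      shift (-((j + 1 : ℕ) : ℤ)) (chromaticFun G) := by
    refine eq_of_evalAt (j + 1) fun q hq => ?_
    obtain ⟨r, rfl⟩ := Nat.exists_eq_add_of_lt hq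
    have : ((j + 1 + r + 1 : ℕ) : ℤ) + -((j + 1 : ℕ) : ℤ) = ((r + 1 : ℕ) : ℤ) := by
      push_cast; ring
    rw [map_mul, evalAt_const, evalAt_shift, this, evalAt_chromaticFun_natCast G _ (by omega),
      evalAt_chromaticFun_natCast G _ (by omega),
      ← indepFun_pow_mul_signed_acyclicFun_pow G (r + 1) (j + 1)]
    congr 2
    ring
  -- The colorings determine the value only at positive integers, so the shift is by `j + 1` and the
  -- identity is evaluated at `1` rather than `0`.
  have h1 := congrArg (evalAt ((1 : ℕ) : ℤ)) h
  rw [map_mul, evalAt_const, evalAt_shift, evalAt_chromaticFun_natCast G 1 one_pos, pow_one,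
    pow_succ', ← mul_assoc, indepFun_mul_signed_acyclicFun, one_mul] at h1
  rw [h1]
  congr 2
  push_cast
  ring

theorem evalAt_chromaticFun_zero : evalAt 0 (chromaticFun G) = 1 := by
  simpa using evalAt_chromaticFun_neg G 0

/-- At `q` this is the power rule for the derivation `point v` applied to `indepFun G ^ q`. -/
theorem point_chromaticFun (v : V) :
    point v (chromaticFun G) = scalar X * (const (signedSourceFun G v) * chromaticFun G) := by
  refine eq_of_evalAt 0 fun q hq => ?_
  obtain ⟨r, rfl⟩ := Nat.exists_eq_succ_of_ne_zero hq.ne'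
  rw [← point_evalAt, map_mul, map_mul, evalAt_const, evalAt_scalar, eval_X,
    evalAt_chromaticFun_natCast G _ hq, Nat.succ_eq_add_one, point_pow_succ, point_indepFun]
  push_cast
  ring

/-- The linear coefficients of the chromatic polynomials of the induced subgraphs. -/
noncomputable def linearFun : SetFun V ℤ := evalAt 0 (formalDeriv (chromaticFun G))

/-- Differentiating `point_chromaticFun` at `0` leaves only the term in which the factor `X` is
differentiated, and there the chromatic factor is `1`. -/
theorem point_linearFun (v : V) : point v (linearFun G) = signedSourceFun G v := by
  rw [linearFun, point_evalAt, point_formalDeriv, point_chromaticFun, formalDeriv_mul, formalDeriv_scalar_X,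
    one_mul, map_add, map_mul, map_mul, evalAt_const, evalAt_scalar, evalAt_chromaticFun_zero]
  simp

theorem val_linearFun_empty : (linearFun G).val ∅ = 0 := by
  rw [linearFun, val_evalAt, val_formalDeriv, val_chromaticFun_empty]
  simp

theorem formalDeriv_chromaticFun :
    formalDeriv (chromaticFun G) = const (linearFun G) * chromaticFun G := by
  refine eq_of_evalAt 0 fun q hq => ?_
  -- The exponential law `χ(r + q) = χ(q) χ(r)`, to be differentiated in `r` at `r = 0`.
  have h : shift (q : ℤ) (chromaticFun G) = const (indepFun G ^ q) * chromaticFun G := by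
    refine eq_of_evalAt 0 fun r hr => ?_
    rw [map_mul, evalAt_const, evalAt_shift, ← Nat.cast_add,
      evalAt_chromaticFun_natCast G _ (by omega), evalAt_chromaticFun_natCast G _ hr, pow_add,
      mul_comm]
  have h1 := congrArg (fun f => evalAt 0 (formalDeriv f)) h
  simp only [formalDeriv_shift, evalAt_shift, formalDeriv_mul, formalDeriv_const, zero_mul, zero_add, map_mul,
    evalAt_const] at h1
  rw [h1, map_mul, evalAt_const, evalAt_chromaticFun_natCast G q hq, mul_comm, linearFun]

theorem iterate_formalDeriv_const_mul_chromaticFun (f : SetFun V ℤ) (i : ℕ) :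
    formalDeriv^[i] (const f * chromaticFun G) = const (f * linearFun G ^ i) * chromaticFun G := by
  induction i with
  | zero => simp
  | succ i ih =>
    rw [Function.iterate_succ_apply', ih, formalDeriv_mul, formalDeriv_const, formalDeriv_chromaticFun, zero_mul,
      zero_add, ← mul_assoc, ← map_mul, pow_succ, mul_assoc]

/-- No independent set contains both `u` and `v`, so the second derivative of `indepFun G` vanishes;
expanding it by `point w I = point w L * I` and cancelling the invertible `I` gives the claim. -/
theorem point_point_linearFun {u v : V} (h : G.Adj u v) :
    point u (point v (linearFun G)) = -(point u (linearFun G) * point v (linearFun G)) := by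
  have h0 : point u (point v (indepFun G)) = 0 := by
    ext U
    by_cases hu : u ∈ U
    · by_cases hv : v ∈ U
      · have : ¬ IsIndepFinset G U := fun hI => hI u hu v hv h
        simp [val_point, indepFun, this]
      · simp [val_point, hv]
    · simp [val_point, hu]
  have hpt : ∀ w, point w (indepFun G) = point w (linearFun G) * indepFun G := fun w => by
    rw [point_indepFun, point_linearFun]
  rw [hpt v, point_mul, hpt u] at h0
  linear_combination signed (acyclicFun G) * h0 - (point u (point v (linearFun G)) +
    point u (linearFun G) * point v (linearFun G)) * indepFun_mul_signed_acyclicFun G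

theorem point_prod_point_linearFun (v : V) (T : Finset V) (h : ∀ u ∈ T, G.Adj v u) :
    point v (∏ u ∈ T, point u (linearFun G)) =
      -(scalar (T.card : ℤ) * (point v (linearFun G) * ∏ u ∈ T, point u (linearFun G))) := by
  induction T using Finset.induction_on with
  | empty => simp [point_one]
  | insert a T ha ih =>
    rw [Finset.prod_insert ha, point_mul, ih fun u hu => h u (Finset.mem_insert_of_mem hu),
      point_point_linearFun G (h a (Finset.mem_insert_self a T)), Finset.card_insert_of_notMem ha]
    push_cast
    rw [map_add (scalar (V := V) (R := ℤ)), map_one]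
    ring

/-- Adding a vertex `a` to the clique `T` applies `point a`. On the chromatic factor it yields `X`,
on the product over `T` it yields `-|T|`, each time with the new factor `point a L`; together they
give the next factor `X - |T|`. -/
theorem pointSet_chromaticFun (T : Finset V) (h : ∀ u ∈ T, ∀ v ∈ T, u ≠ v → G.Adj u v) :
    pointSet T (chromaticFun G) = scalar (∏ k ∈ Finset.range T.card, (X - C (k : ℤ))) *
      (const (∏ u ∈ T, point u (linearFun G)) * chromaticFun G) := by
  induction T using Finset.induction_on with
  | empty => simp [pointSet]
  | insert a T ha ih =>
    have hT := ih fun u hu v hv => h u (Finset.mem_insert_of_mem hu) v (Finset.mem_insert_of_mem hv)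
    have hadj : ∀ u ∈ T, G.Adj a u := fun u hu => h a (Finset.mem_insert_self a T) u
      (Finset.mem_insert_of_mem hu) (by rintro rfl; exact ha hu)
    rw [pointSet_insert, hT, point_mul, point_scalar, point_mul, point_const,
      point_prod_point_linearFun G a T hadj, point_chromaticFun, ← point_linearFun,
      Finset.card_insert_of_notMem ha, Finset.prod_range_succ, Finset.prod_insert ha, map_neg,
      map_mul const, map_mul const, const_scalar, map_mul scalar, map_sub scalar]
    ring

theorem chromaticPoly_eq_of_clique (T : Finset V) (h : ∀ u ∈ T, ∀ v ∈ T, u ≠ v → G.Adj u v) :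
    chromaticPoly G = (∏ k ∈ Finset.range T.card, (X - C (k : ℤ))) *
      (const (∏ u ∈ T, point u (linearFun G)) * chromaticFun G).val Finset.univ := by
  have := congrArg (fun f => f.val Finset.univ) (pointSet_chromaticFun G T h)
  rw [val_scalar_mul] at this
  rw [← this, ← val_chromaticFun_univ]
  simp [pointSet]

/-- The number of acyclic orientations, of the subgraph induced by a set, whose only source is the
least element of the set. -/
noncomputable def minSourceFun [LinearOrder V] : SetFun V ℤ :=
  ⟨fun U => Nat.card {r // IsAcyclicArcs G U r ∧ ∃ h : U.Nonempty, IsUniqueSource U (U.min' h) r}⟩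

/-- Every `v ∈ U` expresses the linear coefficient through orientations with unique source `v`; the
choice `v = min U` makes this a single set function, with value `0` at `∅`. -/
theorem linearFun_eq_neg_signed_minSourceFun [LinearOrder V] :
    linearFun G = -signed (minSourceFun G) := by
  ext U
  rcases U.eq_empty_or_nonempty with rfl | hU
  · rw [val_linearFun_empty]
    simp [val_signed, minSourceFun]
  · rw [← val_point_of_mem (U.min'_mem hU), point_linearFun, signedSourceFun]
    simp only [val_neg, val_signed, minSourceFun, sourceFun]
    congr 4
    simp [hU]

theorem eval_iterate_derivative_neg [LinearOrder V] (T : Finset V) (i j : ℕ) :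
    (derivative^[i] ((const (∏ u ∈ T, point u (linearFun G)) * chromaticFun G).val
      Finset.univ)).eval (-(j : ℤ)) = (-1) ^ (Fintype.card V + T.card + i) *
      ((∏ u ∈ T, point u (minSourceFun G)) * minSourceFun G ^ i * acyclicFun G ^ j).val
        Finset.univ := by
  rw [← val_iterate_formalDeriv, ← val_evalAt, iterate_formalDeriv_const_mul_chromaticFun, map_mul,
    evalAt_const, evalAt_chromaticFun_neg, linearFun_eq_neg_signed_minSourceFun]
  have h : ∀ u, point u (-signed (minSourceFun G)) = -1 * signed (point u (minSourceFun G)) := by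
    intro u
    rw [point_neg, point_signed, neg_one_mul]
  -- Each of the `T.card + i` factors coming from `linearFun` contributes `-1`; `signed`, being
  -- multiplicative, contributes `(-1) ^ |V|` once.
  have h2 : (-1 : SetFun V ℤ) ^ T.card * (-1) ^ i = scalar ((-1) ^ (T.card + i)) := by
    rw [map_pow, map_neg, map_one, pow_add]
  rw [Finset.prod_congr rfl fun u _ => h u, Finset.prod_mul_distrib, Finset.prod_const, ← map_prod,
    neg_pow (signed (minSourceFun G)), ← map_pow, ← map_pow]
  have h3 : ∀ x y z w e : SetFun V ℤ, x * y * (z * w) * e = x * z * (y * w * e) := by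
    intros; ring
  rw [h3, h2, ← map_mul, ← map_mul, val_scalar_mul, val_signed, Finset.card_univ]
  ring

end Chromatic

/-! ### Admissible tuples as values of a product of set functions -/

section Tuples

/-- Acyclic orientations of an induced subgraph as relations on the whole vertex set. -/
def acyclicOrientationEquiv {V : Type*} (G : SimpleGraph V) (U : Finset V) :
    {γ : GraphOrientation (G.induce (U : Set V)) // γ.IsAcyclic} ≃ {r // IsAcyclicArcs G U r} where
  toFun γ := ⟨fun u v => ∃ (hu : u ∈ U) (hv : v ∈ U), γ.1.arc ⟨u, hu⟩ ⟨v, hv⟩, by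
    refine ⟨fun u v => ?_, fun v hv => ?_⟩
    · constructor
      · rintro (⟨hu, hv, h⟩ | ⟨hv, hu, h⟩)
        · exact ⟨hu, hv, (γ.1.adj_iff _ _).2 (Or.inl h)⟩
        · exact ⟨hu, hv, (γ.1.adj_iff ⟨u, hu⟩ ⟨v, hv⟩).2 (Or.inr h)⟩
      · rintro ⟨hu, hv, h⟩
        rcases (γ.1.adj_iff ⟨u, hu⟩ ⟨v, hv⟩).1 h with h | h
        · exact Or.inl ⟨hu, hv, h⟩
        · exact Or.inr ⟨hv, hu, h⟩
    · have key : ∀ x y, Relation.TransGen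
          (fun u v => ∃ (hu : u ∈ U) (hv : v ∈ U), γ.1.arc ⟨u, hu⟩ ⟨v, hv⟩) x y →
          ∃ (hx : x ∈ U) (hy : y ∈ U), Relation.TransGen γ.1.arc ⟨x, hx⟩ ⟨y, hy⟩ := by
        intro x y h
        induction h with
        | single h => exact ⟨h.1, h.2.1, .single h.2.2⟩
        | tail _ h ih => exact ⟨ih.1, h.2.1, ih.2.2.tail h.2.2⟩
      obtain ⟨hx, _, h⟩ := key v v hv
      exact γ.2 _ h⟩
  invFun r := ⟨⟨fun u v => r.1 u v,
    fun u v => ⟨fun h => (r.2.arc_iff u v).2 ⟨u.2, v.2, h⟩, fun h => ((r.2.arc_iff u v).1 h).2.2⟩,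
    fun u v h => r.2.asymm h⟩, fun v hv => r.2.acyclic v (hv.lift Subtype.val fun _ _ h => h)⟩
  left_inv γ := by
    refine Subtype.ext (GraphOrientation.ext ?_)
    funext u v
    exact propext ⟨fun h => h.2.2, fun h => ⟨u.2, v.2, h⟩⟩
  right_inv r := by
    refine Subtype.ext ?_
    funext u v
    exact propext ⟨fun h => h.2.2, fun h => ⟨r.2.mem_left h, r.2.mem_right h, h⟩⟩

variable {n : ℕ} (G : SimpleGraph (Fin n))

theorem hasUniqueSourceMin_iff (U : Finset (Fin n))
    (γ : {γ : GraphOrientation (G.induce (U : Set (Fin n))) // γ.IsAcyclic}) :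
    OrientedPart.HasUniqueSourceMin (⟨U, γ.1⟩ : OrientedPart G) ↔
      ∃ h : U.Nonempty, IsUniqueSource U (U.min' h) (acyclicOrientationEquiv G U γ).1 := by
  have hs : ∀ v : (U : Set (Fin n)),
      γ.1.IsSource v ↔ ∀ u, ¬ (acyclicOrientationEquiv G U γ).1 u v :=
    fun v => ⟨fun h u hu => h ⟨u, hu.1⟩ hu.2.2, fun h u hu => h u ⟨u.2, v.2, hu⟩⟩
  refine exists_congr fun h => ?_
  rw [IsUniqueSource, and_iff_right (U.min'_mem h)]
  constructor
  · intro h1 w hw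
    rw [← h1 ⟨w, hw⟩, hs]
  · intro h1 w
    rw [hs, h1 w w.2]

variable (d i j : ℕ)

/-- The condition on the part in position `k` of an admissible tuple. -/
structure IsAdmissiblePart (k : ℕ) (p : OrientedPart G) : Prop where
  mem : ∀ v : Fin n, k < d → (v : ℕ) = k → v ∈ p.1
  acyclic : p.2.IsAcyclic
  source : k < d + i → p.HasUniqueSourceMin

/-- Admissible tuples as decompositions whose parts are oriented independently of each other. -/
def admissibleTupleEquiv :
    {t : Fin (d + i + j) → OrientedPart G // IsAdmissibleTuple G d i j t} ≃
      Σ s : {s : Fin (d + i + j) → Finset (Fin n) // SetFun.IsDecomposition s Finset.univ},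
        ∀ k, {γ : GraphOrientation (G.induce (s.1 k : Set (Fin n))) //
          IsAdmissiblePart G d i k ⟨s.1 k, γ⟩} where
  toFun t := ⟨⟨fun k => (t.1 k).1, t.2.disjoint, fun v => by simpa using t.2.cover v⟩,
    fun k => ⟨(t.1 k).2, fun v => t.2.mem v k, t.2.acyclic k, t.2.source k⟩⟩
  invFun p := ⟨fun k => ⟨p.1.1 k, (p.2 k).1⟩, p.1.2.disjoint,
    fun v => (p.1.2.cover v).1 (Finset.mem_univ v), fun v k => (p.2 k).2.mem v,
    fun k => (p.2 k).2.acyclic, fun k => (p.2 k).2.source⟩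
  left_inv t := rfl
  right_inv p := rfl

variable {d i}

theorem card_minSource (U : Finset (Fin n)) :
    (Nat.card {γ : GraphOrientation (G.induce (U : Set (Fin n))) //
      γ.IsAcyclic ∧ OrientedPart.HasUniqueSourceMin (⟨U, γ⟩ : OrientedPart G)} : ℤ) =
      (minSourceFun G).val U := by
  rw [minSourceFun]
  congr 1
  exact Nat.card_congr <| (Equiv.subtypeSubtypeEquivSubtypeInter _ _).symm.trans <|
    ((acyclicOrientationEquiv G U).subtypeEquiv (hasUniqueSourceMin_iff G U)).trans <|
      Equiv.subtypeSubtypeEquivSubtypeInter (IsAcyclicArcs G U)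
        (fun r => ∃ h : U.Nonempty, IsUniqueSource U (U.min' h) r)

/-- The requirement that position `k < d` contain vertex `k` is exactly what `point` imposes. -/
theorem card_admissiblePart_of_lt {k : ℕ} (hk : k < d) (hd : d ≤ n) (U : Finset (Fin n)) :
    (Nat.card {γ : GraphOrientation (G.induce (U : Set (Fin n))) //
      IsAdmissiblePart G d i k ⟨U, γ⟩} : ℤ) =
      (SetFun.point ⟨k, hk.trans_le hd⟩ (minSourceFun G)).val U := by
  rw [SetFun.val_point]
  by_cases h : (⟨k, hk.trans_le hd⟩ : Fin n) ∈ U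
  · rw [if_pos h, ← card_minSource]
    congr 1
    refine Nat.card_congr (Equiv.subtypeEquivRight fun γ => ⟨fun h' => ⟨h'.acyclic,
      h'.source (by omega)⟩, fun h' => ⟨fun v _ hv => ?_, h'.1, fun _ => h'.2⟩⟩)
    have : v = ⟨k, hk.trans_le hd⟩ := Fin.ext hv
    exact this ▸ h
  · rw [if_neg h]
    have : IsEmpty {γ : GraphOrientation (G.induce (U : Set (Fin n))) //
        IsAdmissiblePart G d i k ⟨U, γ⟩} := ⟨fun γ => h (γ.2.mem _ hk rfl)⟩
    simp

theorem card_admissiblePart_of_le_of_lt {k : ℕ} (hk : d ≤ k) (hk' : k < d + i)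
    (U : Finset (Fin n)) :
    (Nat.card {γ : GraphOrientation (G.induce (U : Set (Fin n))) //
      IsAdmissiblePart G d i k ⟨U, γ⟩} : ℤ) = (minSourceFun G).val U := by
  rw [← card_minSource]
  congr 1
  exact Nat.card_congr (Equiv.subtypeEquivRight fun γ => ⟨fun h => ⟨h.acyclic, h.source hk'⟩,
    fun h => ⟨fun v h' => by omega, h.1, fun _ => h.2⟩⟩)

theorem card_admissiblePart_of_le {k : ℕ} (hk : d + i ≤ k) (U : Finset (Fin n)) :
    (Nat.card {γ : GraphOrientation (G.induce (U : Set (Fin n))) //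
      IsAdmissiblePart G d i k ⟨U, γ⟩} : ℤ) = (acyclicFun G).val U := by
  rw [acyclicFun]
  congr 1
  exact Nat.card_congr ((Equiv.subtypeEquivRight fun γ => ⟨fun h => h.acyclic,
    fun h => ⟨fun v h' => by omega, h, fun h' => by omega⟩⟩).trans (acyclicOrientationEquiv G U))

variable (d i)

/-- Once the sets are fixed, the parts are oriented independently, so `val_prod` applies with one
factor per position; the three ranges of positions give the three kinds of factor. -/
theorem card_admissibleTuple (hd : d ≤ n) :
    (Nat.card {t : Fin (d + i + j) → OrientedPart G // IsAdmissibleTuple G d i j t} : ℤ) =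
      ((∏ k : Fin d, SetFun.point (Fin.castLE hd k) (minSourceFun G)) * minSourceFun G ^ i *
        acyclicFun G ^ j).val Finset.univ := by
  classical
  let f : Fin (d + i + j) → SetFun (Fin n) ℤ := fun k => ⟨fun U =>
    Nat.card {γ : GraphOrientation (G.induce (U : Set (Fin n))) // IsAdmissiblePart G d i k ⟨U, γ⟩}⟩
  have : Fintype {s : Fin (d + i + j) → Finset (Fin n) // SetFun.IsDecomposition s Finset.univ} :=
    Fintype.ofFinite _
  have h1 : (Nat.card {t : Fin (d + i + j) → OrientedPart G // IsAdmissibleTuple G d i j t} : ℤ) =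
      (∏ k, f k).val Finset.univ := by
    rw [SetFun.val_prod, Nat.card_congr (admissibleTupleEquiv G d i j), Nat.card_sigma]
    push_cast
    refine Finset.sum_congr rfl fun s _ => ?_
    rw [Nat.card_pi]
    push_cast
    rfl
  rw [h1, Fin.prod_univ_add, Fin.prod_univ_add]
  have h2 : ∀ k : Fin d, f (Fin.castAdd j (Fin.castAdd i k)) =
      SetFun.point (Fin.castLE hd k) (minSourceFun G) := fun k =>
    SetFun.ext (funext fun U => card_admissiblePart_of_lt G k.2 hd U)
  have h3 : ∀ k : Fin i, f (Fin.castAdd j (Fin.natAdd d k)) = minSourceFun G := fun k =>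
    SetFun.ext (funext fun U => card_admissiblePart_of_le_of_lt G (by simp) (by simp) U)
  have h4 : ∀ k : Fin j, f (Fin.natAdd (d + i) k) = acyclicFun G := fun k =>
    SetFun.ext (funext fun U => card_admissiblePart_of_le G (by simp) U)
  simp only [h2, h3, h4, Finset.prod_const, Finset.card_univ, Fintype.card_fin]

end Tuples

/-! ### The main theorem -/

theorem mainTheorem2 (n d : ℕ) (hd : d ≤ n) (G : SimpleGraph (Fin n))
    (hG : ∀ u v : Fin n, (u : ℕ) < d → (v : ℕ) < d → u ≠ v → G.Adj u v) :
    ∃ P : ℤ[X], algebraMap ℤ[X] (RatFunc ℤ) P = chromaticQuotient G d ∧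
      ∀ i j : ℕ,
        (((-1 : ℤˣ) ^ ((n : ℤ) - d - i) : ℤˣ) : ℤ) *
            (Polynomial.derivative^[i] P).eval (-(j : ℤ)) =
          Nat.card {t : Fin (d + i + j) → OrientedPart G // IsAdmissibleTuple G d i j t} := by
  have hT : (Finset.univ.map (Fin.castLEEmb hd)).card = d := by simp
  refine ⟨(SetFun.const (∏ u ∈ Finset.univ.map (Fin.castLEEmb hd),
    SetFun.point u (linearFun G)) * chromaticFun G).val Finset.univ, ?_, fun i j => ?_⟩
  · rw [chromaticQuotient, eq_div_iff, ← map_mul]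
    · congr 1
      rw [mul_comm]
      have hP := chromaticPoly_eq_of_clique G (Finset.univ.map (Fin.castLEEmb hd)) (by
        intro u hu v hv huv
        obtain ⟨u, -, rfl⟩ := Finset.mem_map.1 hu
        obtain ⟨v, -, rfl⟩ := Finset.mem_map.1 hv
        exact hG _ _ u.2 v.2 huv)
      rw [hT] at hP
      exact hP.symm
    · rw [Ne, map_eq_zero_iff _ (RatFunc.algebraMap_injective ℤ)]
      exact (monic_prod_of_monic _ _ fun k _ => monic_X_sub_C _).ne_zero
  -- The exponent `n - d - i` may be negative, so the power is taken in the units; it agrees in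
  -- parity with `n + d + i`, the two adding up to `2 * n`.
  · have hsign : (((-1 : ℤˣ) ^ ((n : ℤ) - d - i) : ℤˣ) : ℤ) * (-1) ^ (n + d + i) = 1 := by
      have : ((-1 : ℤˣ) ^ ((n : ℤ) - d - i)) * (-1) ^ (n + d + i) = 1 := by
        rw [← zpow_natCast, ← zpow_add]
        push_cast
        rw [show (n : ℤ) - d - i + (n + d + i) = 2 * n by ring, zpow_mul]
        simp
      simpa only [Units.val_mul, Units.val_pow_eq_pow_val, Units.val_neg, Units.val_one] using
        congrArg Units.val this
    rw [eval_iterate_derivative_neg, hT, Fintype.card_fin, ← mul_assoc, hsign, one_mul,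
      card_admissibleTuple G d i j hd, Finset.prod_map]
    rfl
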